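/- Let $p$ be a prime and $k\geqslant 1$. Let $K$ be a field complete with respect to a normalized discrete valuation $v_K$, with ring of integers $\mathcal{O}_K$, maximal ideal $\mathcal{M}_K$, and perfect residue field $\overline{K}=\mathcal{O}_K/\mathcal{M}_K$ of characteristic $p$. Put $e_K=v_K(p)\in\mathbb{N}\cup\{\infty\}$, let $\mathfrak{R}\subset\mathcal{O}_K$ be the set of Teichmüller representatives, and fix a uniformizer $\pi_K$ of $K$. Consider integers $1\leqslant A_0\leqslant e_K$ (with $A_0<\infty$) and $1\leqslant b_0\leqslant p^k$ with $p\nmid b_0$, and $\omega\in\mathfrak{R}\smallsetminus\{0\}$. Put $i_0=p^kA_0-b_0$ and let $\overline{\psi}_{i_0,\omega}:\overline{K}\to\overline{K}$ be the additive map $x\mapsto x^{p^k}-(-1)^{A_0}\overline{b_0\omega}\,x$. For each such $(i_0,\omega)$ fix a set $T_{i_0,\omega}\subset\mathfrak{R}$ whose image in $\overline{K}$ is a set of coset representatives for $\overline{K}/\overline{\psi}_{i_0,\omega}(\overline{K})$, with $T_{i_0,\omega}=\{0\}$ if $\overline{\psi}_{i_0,\omega}$ is surjective. Let $A_0,b_0,\omega$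 be as above, let $\mathcal{B}=i_0/(p^k-1)$, and let \[f(X)=X^{p^k}+(-1)^{b_0}\omega\pi_K^{A_0}X^{p^k-b_0}+(-1)^{p^k}a\pi_K\in\mathcal{O}_K[X]\] be an Eisenstein polynomial in standard form; that is, there are $\alpha_j\in\mathfrak{R}$ with $\alpha_j=0$ for all $j\equiv b_0\pmod{p^k}$ such that either $\mathcal{B}\notin\mathbb{Z}$ and $a=1+\sum_{j=1}^{\lfloor\mathcal{B}\rfloor}\alpha_j\pi_K^j$, or $\mathcal{B}\in\mathbb{Z}$ and $a=1+\bigl(\sum_{j=1}^{\mathcal{B}-1}\alpha_j\pi_K^j\bigr)+\gamma\pi_K^{\mathcal{B}}$ for some $\gamma\in T_{i_0,\omega}$. Let $L=K(\pi_L)$ be an extension of $K$ generated by a root $\pi_L$ of $f(X)$. Then $L/K$ is Galois if and only if $K$ contains a primitive $(p^k-1)$-th root of unity and there is $y\in K$ with \[y^{p^k-1}=(-1)^{b_0}b_0\,\omega\,\pi_K^{p^k-b_0+A_0-1}.\] In this case $\operatorname{Gal}(L/K)$ is an elementary abelian $p$-group of rank $k$, i.e. $\operatorname{Gal}(L/K)\cong(\mathbb{Z}/p\mathbb{Z})^k$.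 -/

import Mathlib

open Polynomial IsLocalRing
open scoped IntermediateField

/-!
Throughout, `O` is a complete discrete valuation ring (the ring of integers of `K`) with perfect
residue field of characteristic `p`, and `K` is its field of fractions.  The normalized valuation
of `K`, restricted to `O`, is `IsDiscreteValuationRing.addVal O : O → ℕ∞`.
-/

/-- The set of Teichmüller representatives: the image of the Teichmüller map.  As the residue field
is perfect, its perfection (the source of Mathlib's map) is the residue field itself. -/
noncomputable def teichmullerReps (p : ℕ) [Fact p.Prime] (O : Type*) [CommRing O] [IsLocalRing O]
    [IsAdicComplete (maximalIdeal O) O] [CharP (O ⧸ maximalIdeal O) p] : Set O :=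
  Set.range (Perfection.teichmuller p (maximalIdeal O))

/-- The conditions on the numerical data `A₀`, `b₀` and on `ω` of a standard form polynomial of
degree `p ^ k`: `1 ≤ A₀ ≤ e_K = v_K(p)` (where `e_K = ∞` in characteristic `p`),
`1 ≤ b₀ ≤ p ^ k`, `p ∤ b₀`, and `ω` is a nonzero Teichmüller representative. -/
structure IsStandardData (p : ℕ) [Fact p.Prime] (k : ℕ) {O : Type*} [CommRing O] [IsDomain O]
    [IsDiscreteValuationRing O] [IsAdicComplete (maximalIdeal O) O]
    [CharP (O ⧸ maximalIdeal O) p] (A₀ b₀ : ℕ) (ω : O) : Prop where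
  one_le_A : 1 ≤ A₀
  A_le : (A₀ : ℕ∞) ≤ IsDiscreteValuationRing.addVal O (p : O)
  one_le_b : 1 ≤ b₀
  b_le : b₀ ≤ p ^ k
  not_dvd : ¬ p ∣ b₀
  mem : ω ∈ teichmullerReps p O
  ne_zero : ω ≠ 0

/-- The additive map `x ↦ x ^ (p ^ k) - (-1) ^ A₀ * b₀ * ω * x` on the residue field. -/
noncomputable def psiBar (p k : ℕ) {O : Type*} [CommRing O] [IsLocalRing O] (A₀ b₀ : ℕ) (ω : O)
    (x : ResidueField O) : ResidueField O :=
  x ^ (p ^ k) - (-1) ^ A₀ * (b₀ : ResidueField O) * residue O ω * x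

/-- `T` is an admissible choice of the sets `T i₀ ω`, where `i₀ = p ^ k * A₀ - b₀`: each consists of
Teichmüller representatives, its reduction is a set of coset representatives for the residue field
modulo the image of `psiBar`, and it is `{0}` when `psiBar` is surjective.
(The index `i₀` determines `A₀` and `b₀`, since `1 ≤ b₀ ≤ p ^ k`.) -/
structure IsCosetChoice (p : ℕ) [Fact p.Prime] (k : ℕ) {O : Type*} [CommRing O] [IsDomain O]
    [IsDiscreteValuationRing O] [IsAdicComplete (maximalIdeal O) O]
    [CharP (O ⧸ maximalIdeal O) p] (T : ℕ → O → Set O) : Prop where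
  subset : ∀ (A₀ b₀ : ℕ) (ω : O), IsStandardData p k A₀ b₀ ω →
    T (p ^ k * A₀ - b₀) ω ⊆ teichmullerReps p O
  transversal : ∀ (A₀ b₀ : ℕ) (ω : O), IsStandardData p k A₀ b₀ ω →
    ∀ x : ResidueField O, ∃! t : ResidueField O,
      t ∈ residue O '' T (p ^ k * A₀ - b₀) ω ∧ x - t ∈ Set.range (psiBar p k A₀ b₀ ω)
  eq_zero : ∀ (A₀ b₀ : ℕ) (ω : O), IsStandardData p k A₀ b₀ ω →
    Function.Surjective (psiBar p k A₀ b₀ ω) → T (p ^ k * A₀ - b₀) ω = {0}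

/-- The condition on the unit `a`, with `i₀ = p ^ k * A₀ - b₀` and `B = i₀ / (p ^ k - 1)`:
* if `B` is not an integer, `a = 1 + ∑_{1 ≤ j ≤ ⌊B⌋} α_j ϖ ^ j`;
* if `B` is an integer, `a = 1 + ∑_{1 ≤ j ≤ B - 1} α_j ϖ ^ j + γ ϖ ^ B` with `γ ∈ T i₀ ω`;
here the `α_j` are Teichmüller representatives, zero for `j ≡ b₀` modulo `p ^ k`. -/
def IsStandardUnit (p : ℕ) [Fact p.Prime] (k : ℕ) {O : Type*} [CommRing O] [IsDomain O]
    [IsDiscreteValuationRing O] [IsAdicComplete (maximalIdeal O) O]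
    [CharP (O ⧸ maximalIdeal O) p] (ϖ : O) (T : ℕ → O → Set O)
    (A₀ b₀ : ℕ) (ω a : O) : Prop :=
  ∃ α : ℕ → O, (∀ j, α j ∈ teichmullerReps p O) ∧ (∀ j, j ≡ b₀ [MOD p ^ k] → α j = 0) ∧
    ((¬ (p ^ k - 1) ∣ (p ^ k * A₀ - b₀) ∧
        a = 1 + ∑ j ∈ Finset.Icc 1 ((p ^ k * A₀ - b₀) / (p ^ k - 1)), α j * ϖ ^ j) ∨
      ((p ^ k - 1) ∣ (p ^ k * A₀ - b₀) ∧ ∃ γ ∈ T (p ^ k * A₀ - b₀) ω,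
        a = 1 + (∑ j ∈ Finset.Icc 1 ((p ^ k * A₀ - b₀) / (p ^ k - 1) - 1), α j * ϖ ^ j)
          + γ * ϖ ^ ((p ^ k * A₀ - b₀) / (p ^ k - 1))))

/-- `f` is an Eisenstein polynomial of degree `p ^ k` in standard form, with data `A₀`, `b₀`, `ω`
and relative to the uniformizer `ϖ` and the sets of coset representatives `T`. -/
structure IsStandardForm (p : ℕ) [Fact p.Prime] (k : ℕ) {O : Type*} [CommRing O] [IsDomain O]
    [IsDiscreteValuationRing O] [IsAdicComplete (maximalIdeal O) O]
    [CharP (O ⧸ maximalIdeal O) p] (ϖ : O) (T : ℕ → O → Set O)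
    (A₀ b₀ : ℕ) (ω : O) (f : O[X]) : Prop where
  eisenstein : f.IsEisensteinAt (maximalIdeal O)
  degree_eq : f.natDegree = p ^ k
  data : IsStandardData p k A₀ b₀ ω
  form : ∃ a : O, IsStandardUnit p k ϖ T A₀ b₀ ω a ∧
    f = X ^ (p ^ k) + C ((-1) ^ b₀ * ω * ϖ ^ A₀) * X ^ (p ^ k - b₀) + C ((-1) ^ (p ^ k) * a * ϖ)

/-!
Write `q = p ^ k`, `i₀ = q A₀ - b₀`, and let `θ` be the root of `f` in `R = O[X] / (f)`. As `f` is
Eisenstein, `R` is a complete discrete valuation ring with uniformizer `θ`, the same residue field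
`κ` as `O`, and fraction field `L` (`EisensteinRoot`). Since `p` is divisible by `θ ^ (i₀ + 1)`,

`f (θ (1 + W)) = θ ^ q (W ^ q + e θ ^ i₀ (q - b₀) W + higher terms)`, with `e` a unit,

so the Newton polygon in `W` has one slope `B = i₀ / (q - 1)`. The other roots of `f` in `R` have the
form `θ (1 + θ ^ B v)` with `B` an integer and the residue of `v` a root of `X ^ (q - 1) = c`, where
`c` is the residue of `(-1) ^ b₀ b₀ ω` (`RamificationData.exists_of_root`).

If `L / K` is Galois, sending `σ` to the residue of `v`, where `σ θ = θ (1 + θ ^ B v)`, is an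
injective homomorphism from the Galois group to the additive group of `κ`
(`RamificationData.exists_residueHom`). The group is thus elementary abelian of order `q`, and
`X ^ (q - 1) = c` has `q - 1` solutions in `κ`. If conversely `B` is an integer and this equation has
`q - 1` solutions, then Hensel's lemma in `R` gives `q` roots of `f`
(`RamificationData.exists_finset_roots`), so `L` is the splitting field of a separable polynomial.

Finally, `q - 1` is prime to `p`, so by Hensel's lemma in `O` the conditions on `κ` and `B` amount to
those on `K` (`exists_isPrimitiveRoot_iff_residueField`, `exists_pow_eq_unit_mul_iff`); the exponent
`q - b₀ + A₀ - 1` is congruent to `i₀` modulo `q - 1`. Of the unit `a`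
only its residue, which is `1`, enters.
-/

/-! ### Roots of the polynomial near a given root -/

/-- The left side is `f (θ (1 + W)) / θ ^ (p ^ k)` for a root `θ` of a standard form polynomial `f`.
Its Newton polygon in `W` is the segment from `(1, i)` to `(p ^ k, 0)`: the binomial coefficients of
`(1 + W) ^ (p ^ k)` are divisible by `p`, hence by `θ ^ (i + 1)`, and do not affect it. -/
theorem exists_ramification_expansion {S : Type*} [CommRing S] {p k i : ℕ} (hp : p.Prime)
    {θ e : S} (hpθ : θ ^ (i + 1) ∣ (p : S)) (m : ℕ) (W : S) :
    ∃ t s : S, (1 + W) ^ p ^ k - 1 + e * θ ^ i * ((1 + W) ^ m - 1) =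
      W ^ p ^ k + θ ^ i * W * (e * m + θ * t + W * s) := by
  obtain ⟨r, hr⟩ := exists_add_pow_prime_pow_eq hp (1 : S) W k
  obtain ⟨s, hs⟩ := Polynomial.powAddExpansion (1 : S) W m
  obtain ⟨P, hP⟩ := hpθ
  refine ⟨P * r, e * s, ?_⟩
  rw [hr, hs, hP]
  ring

/-- Local data at a root `θ` of `f`. The ring `R = O[θ]` has uniformizer `θ` and residue map `ρ` onto
`κ`, which is also the residue field of `O`. The roots of `f` of the form `θ t` are governed by
`t ^ (p ^ k) - 1 + e θ ^ i (t ^ m - 1)`, where `e m` is a unit. For a standard form polynomial,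
`i = p ^ k A₀ - b₀` and `m = p ^ k - b₀`. -/
structure RamificationData (p k i m : ℕ) {O R κ : Type*} [CommRing O] [CommRing R] [Algebra O R]
    [Field κ] (f : O[X]) (ρ : R →+* κ) (θ e : R) : Prop where
  irreducible : Irreducible θ
  isUnit_iff : ∀ r, IsUnit r ↔ ρ r ≠ 0
  dvd_iff : ∀ r, θ ∣ r ↔ ρ r = 0
  surjective : Function.Surjective (ρ.comp (algebraMap O R))
  adjoin_eq_top : Algebra.adjoin O {θ} = ⊤
  pos : 0 < i
  dvd_prime : θ ^ (i + 1) ∣ (p : R)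
  aeval_mul : ∀ t, aeval (θ * t) f = θ ^ p ^ k * (t ^ p ^ k - 1 + e * θ ^ i * (t ^ m - 1))
  ne_zero : ρ (e * m) ≠ 0

namespace RamificationData

variable {p k i m : ℕ} {O R κ : Type*} [CommRing O] [CommRing R] [Algebra O R]
    [Field κ] {f : O[X]} {ρ : R →+* κ} {θ e : R}

theorem map_uniformizer (h : RamificationData p k i m f ρ θ e) : ρ θ = 0 :=
  (h.dvd_iff θ).1 dvd_rfl

theorem aeval_mul_eq_zero_iff [IsDomain R] (h : RamificationData p k i m f ρ θ e) (t : R) :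
    aeval (θ * t) f = 0 ↔ t ^ p ^ k - 1 + e * θ ^ i * (t ^ m - 1) = 0 := by
  rw [h.aeval_mul, mul_eq_zero, or_iff_right (pow_ne_zero _ h.irreducible.ne_zero)]

/-- A root `θ (1 + W)` other than `θ` has `W = θ ^ B v` with `i = (p ^ k - 1) B`, the slope of the
Newton polygon, and the residue of `v` is a `(p ^ k - 1)`-th root of `-ρ (e m)`. -/
theorem exists_of_root [IsDomain R] [IsDiscreteValuationRing R] (h : RamificationData p k i m f ρ θ e)
    (hp : p.Prime) {W : R} (hW : W ≠ 0) (hroot : aeval (θ * (1 + W)) f = 0) :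
    ∃ B v, i = (p ^ k - 1) * B ∧ W = θ ^ B * v ∧ ρ v ^ (p ^ k - 1) = -ρ (e * m) := by
  rw [h.aeval_mul_eq_zero_iff] at hroot
  obtain ⟨t, s, hts⟩ := exists_ramification_expansion (k := k) (e := e) hp h.dvd_prime m W
  rw [hts] at hroot
  have hq : p ^ k = p ^ k - 1 + 1 := by have := pow_pos hp.pos k; omega
  have hρW : ρ W = 0 := by
    have := congrArg ρ hroot
    simp only [map_add, map_mul, map_pow, h.map_uniformizer, map_zero, zero_pow h.pos.ne',
      zero_mul, add_zero] at this
    exact eq_zero_of_pow_eq_zero this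
  have hx : IsUnit (-(e * m + θ * t + W * s)) := by
    rw [h.isUnit_iff]
    simpa [h.map_uniformizer, hρW] using h.ne_zero
  have hW1 : W ^ (p ^ k - 1) = θ ^ i * -(e * m + θ * t + W * s) := by
    apply mul_right_cancel₀ hW
    rw [← pow_succ, ← hq]
    linear_combination hroot
  -- compare valuations in `hW1`
  obtain ⟨B, v, hv⟩ := IsDiscreteValuationRing.eq_unit_mul_pow_irreducible hW h.irreducible
  have hB : (p ^ k - 1) * B = i := by
    refine IsDiscreteValuationRing.unit_mul_pow_congr_pow h.irreducible h.irreducible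
      (v ^ (p ^ k - 1)) hx.unit _ _ ?_
    rw [IsUnit.unit_spec, mul_comm (-_), ← hW1, hv]
    push_cast
    ring
  refine ⟨B, v, hB.symm, by rw [hv, mul_comm], ?_⟩
  have : (v : R) ^ (p ^ k - 1) = -(e * m + θ * t + W * s) := by
    apply mul_left_cancel₀ (pow_ne_zero i h.irreducible.ne_zero)
    rw [← hW1, hv, ← hB]
    ring
  rw [← map_pow, this]
  simp [h.map_uniformizer, hρW]

/-- Hensel's lemma applied to `f (θ (1 + θ ^ B X)) / θ ^ (p ^ k (B + 1))`, whose reduction is the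
separable additive polynomial `X ^ (p ^ k) + ρ (e m) X`. -/
theorem exists_root_of_residue [IsDomain R] [HenselianLocalRing R] [CharP κ p]
    (h : RamificationData p k i m f ρ θ e) (hp : p.Prime) (hk : k ≠ 0) (hm : m < p ^ k) {B : ℕ}
    (hB : i = (p ^ k - 1) * B) {x : R} (hx : ρ x ^ p ^ k + ρ (e * m) * ρ x = 0) :
    ∃ v, ρ v = ρ x ∧ aeval (θ * (1 + θ ^ B * v)) f = 0 := by
  have hθ : θ ≠ 0 := h.irreducible.ne_zero
  have hB0 : B ≠ 0 := by rintro rfl; exact h.pos.ne' (by simpa using hB)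
  have hq : p ^ k = p ^ k - 1 + 1 := by have := pow_pos hp.pos k; omega
  have hiB : i + B = B * p ^ k := by
    rw [hB]
    conv_rhs => rw [hq]
    ring
  have hpX : (C θ : R[X]) ^ (i + 1) ∣ (p : R[X]) := by
    simpa using map_dvd C h.dvd_prime
  obtain ⟨t, s, hts⟩ := exists_ramification_expansion (k := k) (e := C e) hp hpX m (C (θ ^ B) * X)
  -- `F` is `f (θ (1 + θ ^ B X)) / θ ^ (p ^ k)`, and `g` is its quotient by `θ ^ (B p ^ k)`
  set F : R[X] := (1 + C (θ ^ B) * X) ^ p ^ k - 1 + C e * C θ ^ i * ((1 + C (θ ^ B) * X) ^ m - 1)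
    with hF
  set g : R[X] := X ^ p ^ k + X * (C (e * m) + C θ * (t + C (θ ^ (B - 1)) * X * s)) with hg
  have hFg : F = C (θ ^ (B * p ^ k)) * g := by
    rw [hts, hg, ← hiB]
    obtain ⟨B, rfl⟩ := Nat.exists_eq_succ_of_ne_zero hB0
    have : (C (θ ^ (B + 1)) * X : R[X]) ^ p ^ k = C (θ ^ (i + (B + 1))) * X ^ p ^ k := by
      rw [mul_pow, ← C_pow, ← pow_mul, hiB]
    rw [this]
    simp only [Nat.succ_eq_add_one, Nat.add_sub_cancel, C_mul, C_pow, map_natCast]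
    ring
  -- `g` is monic because `F` has leading coefficient `θ ^ (B p ^ k)`
  have hlin : (1 + C (θ ^ B) * X : R[X]).natDegree = 1 := by
    rw [add_comm, ← C_1]; exact natDegree_linear (pow_ne_zero _ hθ)
  have hlead : (1 + C (θ ^ B) * X : R[X]).leadingCoeff = θ ^ B := by
    rw [add_comm, ← C_1]; exact leadingCoeff_linear (pow_ne_zero _ hθ)
  have hFlead : F.leadingCoeff = θ ^ (B * p ^ k) := by
    have h1 : ((1 + C (θ ^ B) * X : R[X]) ^ p ^ k).natDegree = p ^ k := by
      rw [natDegree_pow, hlin, mul_one]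
    have h2 : (-1 + C e * C θ ^ i * ((1 + C (θ ^ B) * X) ^ m - 1) : R[X]).natDegree ≤ m := by
      rw [← C_pow, ← C_mul]
      refine (natDegree_add_le _ _).trans (max_le (by simp) ?_)
      refine (natDegree_C_mul_le _ _).trans ((natDegree_sub_le _ _).trans (max_le ?_ (by simp)))
      rw [natDegree_pow, hlin, mul_one]
    have h3 : F = (-1 + C e * C θ ^ i * ((1 + C (θ ^ B) * X) ^ m - 1))
        + (1 + C (θ ^ B) * X) ^ p ^ k := by rw [hF]; ring
    rw [h3, leadingCoeff_add_of_degree_lt, leadingCoeff_pow, hlead, pow_mul]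
    apply degree_lt_degree
    omega
  have hmon : g.Monic := by
    have := congrArg leadingCoeff hFg
    rw [hFlead, leadingCoeff_mul, leadingCoeff_C] at this
    exact mul_left_cancel₀ (pow_ne_zero _ hθ) (by rw [← this, mul_one])
  have hgρ : g.map ρ = X ^ p ^ k + C (ρ (e * m)) * X := by
    simp only [hg, Polynomial.map_add, Polynomial.map_mul, Polynomial.map_pow, map_X, map_C,
      h.map_uniformizer, C_0, zero_mul, add_zero]
    ring
  have heval : ∀ r, ρ (g.eval r) = (g.map ρ).eval (ρ r) := fun r ↦ by
    rw [eval_map, eval₂_at_apply]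
  have hder : ∀ r, ρ (g.derivative.eval r) = ρ (e * m) := fun r ↦ by
    have : ρ (g.derivative.eval r) = (g.map ρ).derivative.eval (ρ r) := by
      rw [derivative_map, eval_map, eval₂_at_apply]
    rw [this, hgρ]
    rw [derivative_add, derivative_X_pow]
    simp [hk]
  have hmem : ∀ r, r ∈ maximalIdeal R ↔ ρ r = 0 := fun r ↦ by
    rw [mem_maximalIdeal, mem_nonunits_iff, h.isUnit_iff, not_not]
  obtain ⟨v, hv, hvx⟩ := HenselianLocalRing.is_henselian g hmon x
    (by rw [hmem, heval, hgρ]; simpa using hx)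
    (by rw [h.isUnit_iff, hder]; exact h.ne_zero)
  refine ⟨v, ?_, ?_⟩
  · rwa [hmem, map_sub, sub_eq_zero] at hvx
  · rw [h.aeval_mul_eq_zero_iff]
    have := congrArg (eval v) hFg
    rw [eval_mul, hv.eq_zero, mul_zero, hF] at this
    simpa using this

/-! ### Automorphisms and the residue homomorphism -/

theorem algEquiv_ext (h : RamificationData p k i m f ρ θ e) {s t : R ≃ₐ[O] R}
    (hst : s θ = t θ) : s = t := by
  have : (s : R →ₐ[O] R) = t := AlgHom.ext_of_adjoin_eq_top h.adjoin_eq_top (by simpa using hst)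
  exact AlgEquiv.coe_toAlgHom_injective this

/-- `R / O` is totally ramified, so its automorphisms act trivially on the residue field. -/
theorem residue_algEquiv (h : RamificationData p k i m f ρ θ e) (s : R ≃ₐ[O] R) (r : R) :
    ρ (s r) = ρ r := by
  obtain ⟨o, ho⟩ := h.surjective (ρ r)
  obtain ⟨r', hr'⟩ := (h.dvd_iff (r - algebraMap O R o)).2 (by simpa [sub_eq_zero] using ho.symm)
  have hsθ : ρ (s θ) = 0 := by
    by_contra hne
    exact h.irreducible.not_isUnit (by simpa using (h.isUnit_iff _).2 hne)
  rw [sub_eq_iff_eq_add] at hr'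
  simp [hr', hsθ, h.map_uniformizer]

theorem exists_of_algEquiv [IsDomain R] [IsDiscreteValuationRing R]
    (h : RamificationData p k i m f ρ θ e) (hp : p.Prime) {s : R ≃ₐ[O] R} (hs : s ≠ 1) :
    ∃ B v, i = (p ^ k - 1) * B ∧ s θ = θ * (1 + θ ^ B * v) ∧
      ρ v ^ (p ^ k - 1) = -ρ (e * m) := by
  have hθf : aeval θ f = 0 := by simpa using h.aeval_mul 1
  obtain ⟨t, ht⟩ := (h.dvd_iff (s θ)).2 (by rw [h.residue_algEquiv, h.map_uniformizer])
  have hroot : aeval (θ * (1 + (t - 1))) f = 0 := by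
    rw [add_sub_cancel, ← ht, ← AlgEquiv.coe_toAlgHom, aeval_algHom_apply, hθf, map_zero]
  have ht1 : t - 1 ≠ 0 := by
    intro h0
    refine hs (h.algEquiv_ext ?_)
    rw [ht, sub_eq_zero.1 h0, mul_one, AlgEquiv.one_apply]
  obtain ⟨B, v, hB, hv, hvc⟩ := h.exists_of_root hp ht1 hroot
  exact ⟨B, v, hB, by rw [ht, ← hv, add_sub_cancel], hvc⟩

/-- Writing `s θ = θ (1 + θ ^ B v)`, the residue of `v` is additive in `s`, because
`B > 0` and automorphisms act trivially on `κ`. It vanishes only for `s = 1`: there is a single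
ramification break. -/
theorem exists_residueHom [IsDomain R] [IsDiscreteValuationRing R]
    (h : RamificationData p k i m f ρ θ e) (hp : p.Prime) (hk : k ≠ 0) {B : ℕ}
    (hB : i = (p ^ k - 1) * B) :
    ∃ δ : (R ≃ₐ[O] R) →* Multiplicative κ, Function.Injective δ ∧
      ∀ s, s ≠ 1 → (δ s).toAdd ^ (p ^ k - 1) = -ρ (e * m) := by
  have hθ : θ ≠ 0 := h.irreducible.ne_zero
  have hB0 : B ≠ 0 := by rintro rfl; exact h.pos.ne' (by simpa using hB)
  have hq : 0 < p ^ k - 1 := Nat.sub_pos_of_lt (Nat.one_lt_pow hk hp.one_lt)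
  have key : ∀ s : R ≃ₐ[O] R, ∃ v, s θ = θ * (1 + θ ^ B * v) ∧
      (s ≠ 1 → ρ v ^ (p ^ k - 1) = -ρ (e * m)) := by
    intro s
    by_cases hs : s = 1
    · exact ⟨0, by simp [hs], fun h ↦ (h hs).elim⟩
    · obtain ⟨B', v, hB', hv, hvc⟩ := h.exists_of_algEquiv hp hs
      obtain rfl : B = B' := Nat.eq_of_mul_eq_mul_left hq (hB.symm.trans hB')
      exact ⟨v, hv, fun _ ↦ hvc⟩
  choose v hv hvc using key
  have hmul : ∀ s t, ρ (v (s * t)) = ρ (v s) + ρ (v t) := by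
    intro s t
    have h1 : (s * t) θ = θ * (1 + θ ^ B * v s) * (1 + (θ * (1 + θ ^ B * v s)) ^ B * s (v t)) := by
      rw [AlgEquiv.mul_apply, hv t]
      simp [hv s]
    have h2 : v (s * t) = v s + (1 + θ ^ B * v s) ^ (B + 1) * s (v t) := by
      apply mul_left_cancel₀ (mul_ne_zero hθ (pow_ne_zero B hθ))
      rw [hv] at h1
      rw [mul_pow] at h1
      linear_combination h1
    rw [h2]
    simp [h.map_uniformizer, h.residue_algEquiv, hB0]
  refine ⟨MonoidHom.mk' (fun s ↦ Multiplicative.ofAdd (ρ (v s))) fun s t ↦ by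
    rw [hmul, ofAdd_add], ?_, fun s hs ↦ hvc s hs⟩
  rw [injective_iff_map_eq_one]
  intro s hs
  by_contra hne
  have h0 : ρ (v s) = 0 := ofAdd_eq_one.1 hs
  have := hvc s hne
  rw [h0, zero_pow hq.ne'] at this
  exact h.ne_zero (by simpa using this)

end RamificationData

/-! ### Finite groups embedded in the additive group of a field -/

/-- The image of `δ` is a vector space over `ZMod p` with `p ^ k` elements. -/
theorem nonempty_mulEquiv_of_injective {p k : ℕ} [Fact p.Prime] {G κ : Type*} [Group G]
    [CommRing κ] [CharP κ p] {δ : G →* Multiplicative κ} (hδ : Function.Injective δ)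
    (hG : Nat.card G = p ^ k) : Nonempty (G ≃* Multiplicative (Fin k → ZMod p)) := by
  let _ : Module (ZMod p) κ := (ZMod.castHom (dvd_refl p) κ).toModule
  let H : Submodule (ZMod p) κ :=
    AddSubgroup.toZModSubmodule p (AddMonoidHom.range (MonoidHom.toAdditiveLeft δ))
  have hGH : Nat.card H = p ^ k := by
    rw [← hG]
    exact (Nat.card_congr (MonoidHom.ofInjective hδ).toEquiv).symm
  have : Finite H := Nat.finite_of_card_ne_zero (by
    rw [hGH]; exact pow_ne_zero _ (Fact.out : p.Prime).ne_zero)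
  have hrank : Module.finrank (ZMod p) H = Module.finrank (ZMod p) (Fin k → ZMod p) := by
    have := Module.natCard_eq_pow_finrank (K := ZMod p) (V := H)
    rw [hGH, Nat.card_zmod] at this
    rw [Module.finrank_fin_fun]
    exact (Nat.pow_right_injective (Fact.out : p.Prime).two_le this).symm
  let e₁ : G ≃* Multiplicative H := MulEquiv.mk' ((MonoidHom.ofInjective hδ).toEquiv)
    fun x y ↦ (MonoidHom.ofInjective hδ).map_mul x y
  exact ⟨e₁.trans (LinearEquiv.ofFinrankEq _ _ hrank).toAddEquiv.toMultiplicative⟩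

/-- The `n` distinct values of `δ` off `1` are roots of `X ^ n - c`; their quotients by one of them
are all the `n`-th roots of unity, which form a cyclic group. -/
theorem exists_isPrimitiveRoot_of_injective {n : ℕ} {G κ : Type*} [Group G]
    [Field κ] {δ : G → κ} (hδ : Function.Injective δ) {c : κ} (hc : c ≠ 0) (hn : n ≠ 0)
    (hpow : ∀ s, s ≠ 1 → δ s ^ n = c) (hG : Nat.card G = n + 1) :
    (∃ ζ : κ, IsPrimitiveRoot ζ n) ∧ ∃ x : κ, x ^ n = c := by
  classical
  have : Finite G := Nat.finite_of_card_ne_zero (by omega)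
  have : Nontrivial G := Finite.one_lt_card_iff_nontrivial.1 (by omega)
  obtain ⟨s₀, hs₀⟩ := exists_ne (1 : G)
  have h0 : ∀ s, s ≠ 1 → δ s ≠ 0 := fun s hs h ↦ hc (by rw [← hpow s hs, h, zero_pow hn])
  refine ⟨?_, δ s₀, hpow s₀ hs₀⟩
  have : NeZero n := ⟨hn⟩
  rw [← card_rootsOfUnity_eq_iff_exists_isPrimitiveRoot]
  refine le_antisymm (by simpa using card_rootsOfUnity κ n) ?_
  have hcard : Nat.card {s : G // s ≠ 1} = n := by
    have := Nat.card_congr (Equiv.sumCompl (fun s : G ↦ s = 1))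
    rw [Nat.card_sum, Nat.card_unique, hG, add_comm] at this
    exact Nat.succ_injective this
  conv_lhs => rw [← hcard]
  let g : {s : G // s ≠ 1} → rootsOfUnity n κ := fun s ↦
    rootsOfUnity.mkOfPowEq (δ s / δ s₀) (by rw [div_pow, hpow s s.2, hpow s₀ hs₀, div_self hc])
  refine Nat.card_le_card_of_injective g fun s t hst ↦ ?_
  have : δ s / δ s₀ = δ t / δ s₀ := by
    have := congrArg (fun x : rootsOfUnity n κ ↦ ((x : κˣ) : κ)) hst
    simpa [g] using this
  exact Subtype.ext (hδ ((div_left_inj' (h0 _ hs₀)).1 this))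

/-! ### The ring generated by a root of an Eisenstein polynomial -/

namespace EisensteinRoot

variable {O : Type*} [CommRing O] [IsDomain O] [IsDiscreteValuationRing O]
  {ϖ : O} {n : ℕ} {f g : O[X]}

/-- The map `O[X] / (f) → O / 𝔪` that evaluates at `X = 0`, for `f = X ^ n + ϖ g`. -/
noncomputable def residueMap (hϖ : Irreducible ϖ) (hn : n ≠ 0) (hf : f = X ^ n + C ϖ * g) :
    AdjoinRoot f →+* ResidueField O :=
  AdjoinRoot.lift (residue O) 0 (by
    have : residue O ϖ = 0 := (residue_eq_zero_iff _).2 hϖ.not_isUnit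
    simp [hf, this, hn])

@[simp] theorem residueMap_root (hϖ : Irreducible ϖ) (hn : n ≠ 0)
    (hf : f = X ^ n + C ϖ * g) : residueMap hϖ hn hf (AdjoinRoot.root f) = 0 :=
  AdjoinRoot.lift_root _

@[simp] theorem residueMap_algebraMap (hϖ : Irreducible ϖ) (hn : n ≠ 0)
    (hf : f = X ^ n + C ϖ * g) (o : O) :
    residueMap hϖ hn hf (algebraMap O (AdjoinRoot f) o) = residue O o :=
  AdjoinRoot.lift_of _

theorem root_pow {O : Type*} [CommRing O] {ϖ : O} {n : ℕ} {f g : O[X]} (hf : f = X ^ n + C ϖ * g) : AdjoinRoot.root f ^ n =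
    algebraMap O (AdjoinRoot f) ϖ * -aeval (AdjoinRoot.root f) g := by
  have h : aeval (AdjoinRoot.root f) (X ^ n + C ϖ * g) = 0 := by
    rw [← hf, AdjoinRoot.aeval_eq, AdjoinRoot.mk_self]
  simp only [map_add, map_mul, map_pow, aeval_X, aeval_C] at h
  linear_combination h

theorem residueMap_aeval (hϖ : Irreducible ϖ) (hn : n ≠ 0)
    (hf : f = X ^ n + C ϖ * g) (r : O[X]) :
    residueMap hϖ hn hf (aeval (AdjoinRoot.root f) r) = residue O (r.coeff 0) := by
  rw [AdjoinRoot.aeval_eq, residueMap, AdjoinRoot.lift_mk, coeff_zero_eq_eval_zero,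
    ← eval₂_at_apply, map_zero]

/-- In particular `O[X] / (f)` is local: by integrality a maximal ideal contains `ϖ`, hence the root. -/
theorem isUnit_iff (hϖ : Irreducible ϖ) (hn : n ≠ 0)
    (hf : f = X ^ n + C ϖ * g) (hmon : f.Monic) (r : AdjoinRoot f) :
    IsUnit r ↔ residueMap hϖ hn hf r ≠ 0 := by
  refine ⟨fun h ↦ (h.map _).ne_zero, fun h ↦ ?_⟩
  by_contra hr
  have := hmon.finite_adjoinRoot
  obtain ⟨M, hM, hrM⟩ := exists_max_ideal_of_mem_nonunits hr
  -- `M` contracts to the maximal ideal of `O`, hence contains `ϖ` and so the root.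
  have hMO : (M.comap (algebraMap O (AdjoinRoot f))).IsMaximal :=
    Ideal.isMaximal_comap_of_isIntegral_of_isMaximal M
  have hMO' := eq_maximalIdeal hMO
  have hϖM : algebraMap O (AdjoinRoot f) ϖ ∈ M := by
    rw [← Ideal.mem_comap, hMO']
    exact hϖ.not_isUnit
  have hθM : AdjoinRoot.root f ∈ M := by
    apply hM.isPrime.mem_of_pow_mem n
    rw [root_pow hf]
    exact M.mul_mem_right _ hϖM
  induction r using AdjoinRoot.induction_on with
  | ih s =>
    rw [← AdjoinRoot.aeval_eq] at h hrM
    rw [residueMap_aeval hϖ hn hf, residue_ne_zero_iff_isUnit] at h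
    have h0 : algebraMap O (AdjoinRoot f) (s.coeff 0) ∈ M := by
      obtain ⟨t, ht⟩ := X_dvd_sub_C (p := s)
      have := congrArg (aeval (AdjoinRoot.root f)) ht
      simp only [map_sub, map_mul, aeval_X, aeval_C] at this
      rw [← sub_sub_cancel (aeval (AdjoinRoot.root f) s) (algebraMap O _ (s.coeff 0)), this]
      exact M.sub_mem hrM (M.mul_mem_right _ hθM)
    exact hM.ne_top (M.eq_top_of_isUnit_mem h0 (h.map _))

/-- Total ramification: the `n`-th power of the root is associated to `ϖ`. -/
theorem exists_unit (hϖ : Irreducible ϖ) (hn : n ≠ 0)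
    (hf : f = X ^ n + C ϖ * g) (hmon : f.Monic) (hg : IsUnit (g.coeff 0)) :
    ∃ w : (AdjoinRoot f)ˣ, AdjoinRoot.root f ^ n = algebraMap O (AdjoinRoot f) ϖ * w ∧
      residueMap hϖ hn hf w = -residue O (g.coeff 0) := by
  have hw : residueMap hϖ hn hf (-aeval (AdjoinRoot.root f) g)
      = -residue O (g.coeff 0) := by
    rw [map_neg, residueMap_aeval hϖ hn hf]
  have hu : IsUnit (-aeval (AdjoinRoot.root f) g) := by
    rw [isUnit_iff hϖ hn hf hmon, hw, neg_ne_zero, residue_ne_zero_iff_isUnit]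
    exact hg
  exact ⟨hu.unit, root_pow hf, hw⟩

theorem dvd_iff (hϖ : Irreducible ϖ) (hn : n ≠ 0)
    (hf : f = X ^ n + C ϖ * g) (hmon : f.Monic) (hg : IsUnit (g.coeff 0)) (r : AdjoinRoot f) :
    AdjoinRoot.root f ∣ r ↔ residueMap hϖ hn hf r = 0 := by
  constructor
  · rintro ⟨s, rfl⟩
    rw [map_mul, residueMap_root, zero_mul]
  · intro h
    induction r using AdjoinRoot.induction_on with
    | ih s =>
    rw [← AdjoinRoot.aeval_eq] at h ⊢
    rw [residueMap_aeval hϖ hn hf, residue_eq_zero_iff, hϖ.maximalIdeal_eq, Ideal.mem_span_singleton] at h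
    obtain ⟨w, hw, -⟩ := exists_unit hϖ hn hf hmon hg
    have hθϖ : AdjoinRoot.root f ∣ algebraMap O (AdjoinRoot f) ϖ := by
      rw [← Units.dvd_mul_right (u := w), ← hw]
      exact dvd_pow_self _ hn
    obtain ⟨t, ht⟩ := X_dvd_sub_C (p := s)
    rw [eq_add_of_sub_eq ht, map_add, map_mul, aeval_X, aeval_C]
    exact dvd_add (dvd_mul_right _ _) (hθϖ.trans (map_dvd _ h))

theorem isLocalRing (hϖ : Irreducible ϖ) (hn : n ≠ 0)
    (hf : f = X ^ n + C ϖ * g) (hmon : f.Monic) : IsLocalRing (AdjoinRoot f) := by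
  have : Nontrivial (AdjoinRoot f) := (residueMap hϖ hn hf).domain_nontrivial
  refine .of_nonunits_add fun a b ha hb ↦ ?_
  rw [mem_nonunits_iff, isUnit_iff hϖ hn hf hmon, not_not] at ha hb ⊢
  rw [map_add, ha, hb, add_zero]

theorem maximalIdeal_eq [IsLocalRing (AdjoinRoot f)] (hϖ : Irreducible ϖ) (hn : n ≠ 0)
    (hf : f = X ^ n + C ϖ * g) (hmon : f.Monic) (hg : IsUnit (g.coeff 0)) :
    maximalIdeal (AdjoinRoot f) = Ideal.span {AdjoinRoot.root f} := by
  ext r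
  rw [mem_maximalIdeal, mem_nonunits_iff, isUnit_iff hϖ hn hf hmon, not_not,
    Ideal.mem_span_singleton, dvd_iff hϖ hn hf hmon hg]

theorem root_ne_zero [IsDomain (AdjoinRoot f)] (hϖ : Irreducible ϖ) (hn : n ≠ 0)
    (hf : f = X ^ n + C ϖ * g) (hmon : f.Monic) (hg : IsUnit (g.coeff 0)) :
    AdjoinRoot.root f ≠ 0 := by
  intro h
  obtain ⟨w, hw, -⟩ := exists_unit hϖ hn hf hmon hg
  have := hmon.free_adjoinRoot
  rw [h, zero_pow hn, zero_eq_mul, or_iff_left w.ne_zero] at hw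
  exact hϖ.ne_zero ((FaithfulSMul.algebraMap_eq_zero_iff O (AdjoinRoot f)).1 hw)

theorem isDiscreteValuationRing [IsDomain (AdjoinRoot f)] (hϖ : Irreducible ϖ) (hn : n ≠ 0)
    (hf : f = X ^ n + C ϖ * g) (hmon : f.Monic)
    (hg : IsUnit (g.coeff 0)) : IsDiscreteValuationRing (AdjoinRoot f) := by
  have := isLocalRing hϖ hn hf hmon
  have := hmon.finite_adjoinRoot
  have : IsNoetherianRing (AdjoinRoot f) := IsNoetherianRing.of_finite O _
  have hmax := maximalIdeal_eq hϖ hn hf hmon hg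
  have hfield : ¬ IsField (AdjoinRoot f) := by
    rw [isField_iff_maximalIdeal_eq, hmax, Ideal.span_singleton_eq_bot]
    exact root_ne_zero hϖ hn hf hmon hg
  have hprin : (maximalIdeal (AdjoinRoot f)).IsPrincipal := ⟨⟨AdjoinRoot.root f, hmax⟩⟩
  exact ((IsDiscreteValuationRing.TFAE (AdjoinRoot f) hfield).out 0 4).2 hprin

/-- `O[X] / (f)` is a finite free `O`-module, so it is complete for the topology of `ϖ`, which is
also the topology of the root. -/
theorem isAdicComplete [IsDomain (AdjoinRoot f)] [IsLocalRing (AdjoinRoot f)]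
    [IsAdicComplete (maximalIdeal O) O] (hϖ : Irreducible ϖ) (hn : n ≠ 0)
    (hf : f = X ^ n + C ϖ * g) (hmon : f.Monic) (hg : IsUnit (g.coeff 0)) :
    IsAdicComplete (maximalIdeal (AdjoinRoot f)) (AdjoinRoot f) := by
  have := hmon.finite_adjoinRoot
  have := hmon.free_adjoinRoot
  have : IsNoetherianRing (AdjoinRoot f) := IsNoetherianRing.of_finite O _
  obtain ⟨w, hw, -⟩ := exists_unit hϖ hn hf hmon hg
  have hmax := maximalIdeal_eq hϖ hn hf hmon hg
  have hR : ∀ (j : ℕ) (a b : AdjoinRoot f),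
      a ≡ b [SMOD (maximalIdeal (AdjoinRoot f) ^ j • ⊤ : Submodule (AdjoinRoot f) _)] ↔
        AdjoinRoot.root f ^ j ∣ a - b := fun j a b ↦ by
    rw [SModEq.sub_mem, smul_eq_mul, Ideal.mul_top, hmax, Ideal.span_singleton_pow,
      Ideal.mem_span_singleton]
  have hO : ∀ (j : ℕ) (a b : O),
      a ≡ b [SMOD (maximalIdeal O ^ j • ⊤ : Submodule O O)] ↔ ϖ ^ j ∣ a - b := fun j a b ↦ by
    rw [SModEq.sub_mem, smul_eq_mul, Ideal.mul_top, hϖ.maximalIdeal_eq, Ideal.span_singleton_pow,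
      Ideal.mem_span_singleton]
  have hpow : ∀ (j : ℕ) (r : AdjoinRoot f),
      AdjoinRoot.root f ^ (n * j) ∣ r ↔ algebraMap O (AdjoinRoot f) (ϖ ^ j) ∣ r := fun j r ↦ by
    rw [pow_mul, hw, mul_pow, map_pow, ← Units.val_pow_eq_pow_val, Units.mul_right_dvd]
  refine { prec' := fun c hc ↦ ?_ }
  let b := Module.Free.chooseBasis O (AdjoinRoot f)
  -- limits of the coordinates along the subsequence `c (n j)`, which is Cauchy for `ϖ`
  have hlim : ∀ l, ∃ x : O, ∀ j, ϖ ^ j ∣ b.repr (c (n * j)) l - x := by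
    intro l
    obtain ⟨x, hx⟩ := IsPrecomplete.prec (I := maximalIdeal O) (M := O) inferInstance
      (f := fun j ↦ b.repr (c (n * j)) l) (fun {j j'} hjj ↦ by
        rw [hO]
        obtain ⟨r, hr⟩ := (hpow j _).1 ((hR _ _ _).1 (hc (Nat.mul_le_mul_left n hjj)))
        have : b.repr (c (n * j) - c (n * j')) l = ϖ ^ j * b.repr r l := by
          rw [hr, ← Algebra.smul_def, map_smul, Finsupp.smul_apply, smul_eq_mul]
        rw [← Finsupp.sub_apply, ← map_sub, this]
        exact dvd_mul_right _ _)
    exact ⟨x, fun j ↦ (hO _ _ _).1 (hx j)⟩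
  choose x hx using hlim
  refine ⟨∑ l, x l • b l, fun j ↦ (hR _ _ _).2 ?_⟩
  have h1 : AdjoinRoot.root f ^ j ∣ c j - c (n * j) :=
    (hR _ _ _).1 (hc (Nat.le_mul_of_pos_left j (Nat.pos_of_ne_zero hn)))
  have h2 : AdjoinRoot.root f ^ (n * j) ∣ c (n * j) - ∑ l, x l • b l := by
    rw [hpow]
    conv_rhs => rw [← b.sum_repr (c (n * j)), ← Finset.sum_sub_distrib]
    refine Finset.dvd_sum fun l _ ↦ ?_
    rw [← sub_smul, Algebra.smul_def]
    exact (_root_.map_dvd _ (hx l j)).mul_right _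
  have h3 := dvd_add h1 ((pow_dvd_pow _ (Nat.le_mul_of_pos_left j (Nat.pos_of_ne_zero hn))).trans h2)
  rwa [sub_add_sub_cancel] at h3

end EisensteinRoot

/-! ### Descent to the residue field -/

/-- Hensel's lemma for `X ^ n - c`, with `n` invertible in the residue field. -/
theorem exists_pow_eq_of_residue {O : Type*} [CommRing O] [HenselianLocalRing O] {n : ℕ}
    (hn : (n : ResidueField O) ≠ 0) {c : O} (hc : IsUnit c) {x : ResidueField O}
    (hx : x ^ n = residue O c) : ∃ v : O, v ^ n = c ∧ residue O v = x := by
  have hn0 : n ≠ 0 := by rintro rfl; simp at hn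
  obtain ⟨a, rfl⟩ := residue_surjective x
  have ha : residue O a ≠ 0 := fun h ↦ by
    rw [h, zero_pow hn0] at hx
    exact (residue_ne_zero_iff_isUnit c).2 hc hx.symm
  obtain ⟨v, hv, hva⟩ := HenselianLocalRing.is_henselian (X ^ n - C c) (monic_X_pow_sub_C c hn0) a
    (by rw [← residue_eq_zero_iff]; simp [hx])
    (by
      rw [← residue_ne_zero_iff_isUnit]
      rw [derivative_sub, derivative_C, sub_zero, derivative_X_pow]
      simp only [eval_mul, eval_natCast, eval_pow, eval_X, map_mul, map_pow, map_natCast]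
      exact mul_ne_zero hn (pow_ne_zero _ ha))
  refine ⟨v, by simpa [sub_eq_zero] using hv, ?_⟩
  rwa [← residue_eq_zero_iff, map_sub, sub_eq_zero] at hva

theorem exists_isPrimitiveRoot_iff_residueField {O K : Type*} [CommRing O] [IsDomain O]
    [HenselianLocalRing O] [IsIntegrallyClosed O] [Field K] [Algebra O K] [IsFractionRing O K]
    {n : ℕ} (hn : (n : ResidueField O) ≠ 0) :
    (∃ ζ : K, IsPrimitiveRoot ζ n) ↔ ∃ ζ : ResidueField O, IsPrimitiveRoot ζ n := by
  have hn0 : 0 < n := Nat.pos_of_ne_zero (by rintro rfl; simp at hn)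
  constructor
  · rintro ⟨ζ, hζ⟩
    obtain ⟨ξ, rfl⟩ := IsIntegrallyClosed.exists_algebraMap_eq_of_isIntegral_pow (R := O) hn0
      (by rw [hζ.pow_eq_one]; exact isIntegral_one)
    have hξ := hζ.of_map_of_injective (IsFractionRing.injective O K)
    refine ⟨residue O ξ, by rw [← map_pow, hξ.pow_eq_one, map_one], fun l hl ↦ ?_⟩
    -- an `n`-th root of unity reducing to `1` equals `1`, because `1 + x + ⋯ + x ^ (n - 1)`
    -- reduces to `n`
    apply hξ.dvd_of_pow_eq_one
    have h1 : (∑ j ∈ Finset.range n, (ξ ^ l) ^ j) * (ξ ^ l - 1) = 0 := by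
      rw [geom_sum_mul, ← pow_mul, mul_comm, pow_mul, hξ.pow_eq_one, one_pow, sub_self]
    rcases mul_eq_zero.1 h1 with h | h
    · refine (hn ?_).elim
      simpa [hl] using congrArg (residue O) h
    · exact sub_eq_zero.1 h
  · rintro ⟨ζ, hζ⟩
    obtain ⟨ξ, hξ, rfl⟩ := exists_pow_eq_of_residue hn isUnit_one
      (by rw [hζ.pow_eq_one, map_one])
    have : IsPrimitiveRoot ξ n := ⟨hξ, fun l hl ↦ hζ.dvd_of_pow_eq_one l (by
      rw [← map_pow, hl, map_one])⟩
    exact ⟨_, this.map_of_injective (IsFractionRing.injective O K)⟩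

theorem exists_pow_eq_unit_mul_iff {O K : Type*} [CommRing O] [IsDomain O]
    [IsDiscreteValuationRing O] [HenselianLocalRing O] [Field K] [Algebra O K]
    [IsFractionRing O K] {n N : ℕ} (hn : (n : ResidueField O) ≠ 0) {c ϖ : O} (hc : IsUnit c)
    (hϖ : Irreducible ϖ) :
    (∃ y : K, y ^ n = algebraMap O K (c * ϖ ^ N)) ↔
      n ∣ N ∧ ∃ x : ResidueField O, x ^ n = residue O c := by
  have hn0 : n ≠ 0 := by rintro rfl; simp at hn
  constructor
  · rintro ⟨y, hy⟩
    obtain ⟨z, rfl⟩ := IsIntegrallyClosed.exists_algebraMap_eq_of_isIntegral_pow (R := O)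
      (Nat.pos_of_ne_zero hn0) (by rw [hy]; exact isIntegral_algebraMap)
    rw [← map_pow] at hy
    replace hy := IsFractionRing.injective O K hy
    have hz : z ≠ 0 := by
      rintro rfl
      rw [zero_pow hn0, zero_eq_mul] at hy
      exact hy.elim hc.ne_zero (pow_ne_zero _ hϖ.ne_zero)
    obtain ⟨l, v, rfl⟩ := IsDiscreteValuationRing.eq_unit_mul_pow_irreducible hz hϖ
    have hl : n * l = N := by
      refine IsDiscreteValuationRing.unit_mul_pow_congr_pow hϖ hϖ (v ^ n) hc.unit _ _ ?_
      rw [IsUnit.unit_spec, ← hy]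
      push_cast
      ring
    refine ⟨⟨l, hl.symm⟩, residue O v, ?_⟩
    rw [mul_pow, ← pow_mul, mul_comm l, hl] at hy
    rw [← map_pow, mul_right_cancel₀ (pow_ne_zero _ hϖ.ne_zero) hy]
  · rintro ⟨⟨l, rfl⟩, x, hx⟩
    obtain ⟨v, rfl, -⟩ := exists_pow_eq_of_residue hn hc hx
    exact ⟨algebraMap O K (v * ϖ ^ l), by rw [← map_pow]; congr 1; ring⟩

/-! ### A criterion for being Galois -/

/-- If `X ^ (p ^ k) + ρ (e m) X` has all its roots in `κ`, they lift to `p ^ k` distinct roots of `f`. -/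
theorem RamificationData.exists_finset_roots {p k i m : ℕ} {O R κ : Type*} [CommRing O]
    [CommRing R] [IsDomain R] [HenselianLocalRing R] [Algebra O R] [Field κ] [CharP κ p]
    {f : O[X]} {ρ : R →+* κ} {θ e : R} (h : RamificationData p k i m f ρ θ e)
    (hρ : Function.Surjective ρ) (hp : p.Prime)
    (hk : k ≠ 0) (hm : m < p ^ k) (hi : (p ^ k - 1) ∣ i) {ζ x : κ}
    (hζ : IsPrimitiveRoot ζ (p ^ k - 1)) (hx : x ^ (p ^ k - 1) = -ρ (e * m)) :
    ∃ Z : Finset R, Z.card = p ^ k ∧ ∀ z ∈ Z, aeval z f = 0 := by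
  classical
  obtain ⟨B, hB⟩ := hi
  have hθ : θ ≠ 0 := h.irreducible.ne_zero
  have hq0 : p ^ k - 1 ≠ 0 := (Nat.sub_pos_of_lt (Nat.one_lt_pow hk hp.one_lt)).ne'
  have hq : p ^ k = p ^ k - 1 + 1 := by have := pow_pos hp.pos k; omega
  have hx0 : x ≠ 0 := by
    rintro rfl
    rw [zero_pow hq0] at hx
    exact h.ne_zero (by simpa using hx)
  -- the roots of `X ^ (p ^ k) + ρ (e m) X` are `0` and the `x ζ ^ j`
  let Y : Finset κ := insert 0 ((nthRootsFinset (p ^ k - 1) (1 : κ)).image (x * ·))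
  have hYcard : Y.card = p ^ k := by
    rw [Finset.card_insert_of_notMem, Finset.card_image_of_injective _ (mul_right_injective₀ hx0),
      hζ.card_nthRootsFinset, ← hq]
    intro h0
    obtain ⟨r, hr, hr0⟩ := Finset.mem_image.1 h0
    rw [mul_eq_zero, or_iff_right hx0] at hr0
    rw [hr0, mem_nthRootsFinset (Nat.pos_of_ne_zero hq0), zero_pow hq0] at hr
    exact zero_ne_one hr
  have hYroot : ∀ y ∈ Y, y ^ p ^ k + ρ (e * m) * y = 0 := by
    intro y hy
    rcases Finset.mem_insert.1 hy with rfl | hy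
    · rw [zero_pow (by omega), mul_zero, add_zero]
    · obtain ⟨r, hr, rfl⟩ := Finset.mem_image.1 hy
      rw [mem_nthRootsFinset (Nat.pos_of_ne_zero hq0)] at hr
      have : (x * r) ^ (p ^ k - 1) = -ρ (e * m) := by rw [mul_pow, hr, hx, mul_one]
      rw [hq, pow_succ, this]
      ring
  have hlift : ∀ y : Y, ∃ v, ρ v = y ∧ aeval (θ * (1 + θ ^ B * v)) f = 0 := by
    rintro ⟨y, hy⟩
    obtain ⟨a, rfl⟩ := hρ y
    exact h.exists_root_of_residue hp hk hm hB (hYroot _ hy)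
  choose v hv hvroot using hlift
  have hinj : Function.Injective fun y ↦ θ * (1 + θ ^ B * v y) := by
    intro y z hyz
    have h1 := add_left_cancel (mul_left_cancel₀ hθ hyz)
    have h2 := mul_left_cancel₀ (pow_ne_zero B hθ) h1
    exact Subtype.ext (by rw [← hv y, h2, hv z])
  refine ⟨Finset.univ.image fun y ↦ θ * (1 + θ ^ B * v y), ?_, ?_⟩
  · rw [Finset.card_image_of_injective _ hinj, Finset.card_univ, Fintype.card_coe, hYcard]
  · intro z hz
    obtain ⟨y, -, rfl⟩ := Finset.mem_image.1 hz
    exact hvroot y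

theorem isGalois_of_card_roots {K L : Type*} [Field K] [Field L] [Algebra K L] {F : K[X]}
    (hF : F ≠ 0) {x : L} (hx : aeval x F = 0) (hgen : K⟮x⟯ = ⊤) {Z : Finset L}
    (hZ : ∀ z ∈ Z, aeval z F = 0) (hcard : Z.card = F.natDegree) : IsGalois K L := by
  have hle : Z.val ≤ F.aroots L := by
    rw [Multiset.le_iff_subset Z.nodup]
    intro z hz
    rw [mem_aroots]
    exact ⟨hF, hZ z hz⟩
  have hFL : (F.map (algebraMap K L)).natDegree = F.natDegree := natDegree_map _
  have heq : Z.val = F.aroots L := by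
    refine Multiset.eq_of_le_of_card_le hle ?_
    refine (card_roots' _).trans ?_
    rw [hFL, ← hcard]
    rfl
  have hsplit : (F.map (algebraMap K L)).Splits := by
    rw [splits_iff_card_roots, hFL, ← hcard]
    exact congrArg Multiset.card heq.symm
  have hsep : F.Separable := by
    rw [← nodup_aroots_iff_of_splits hF hsplit, ← heq]
    exact Z.nodup
  have : IsSplittingField K L F := by
    refine ⟨hsplit, ?_⟩
    have hxint : IsAlgebraic K x := ⟨F, hF, hx⟩
    have h1 : Algebra.adjoin K {x} = ⊤ := by
      rw [← IntermediateField.adjoin_simple_toSubalgebra_of_isAlgebraic hxint, hgen,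
        IntermediateField.top_toSubalgebra]
    rw [eq_top_iff, ← h1]
    refine Algebra.adjoin_mono ?_
    rw [Set.singleton_subset_iff, mem_rootSet]
    exact ⟨hF, hx⟩
  exact IsGalois.of_separable_splitting_field hsep

/-! ### Standard form polynomials -/

/-- The only property of the unit `a` that matters: it is congruent to `1` modulo `ϖ`. -/
theorem IsStandardUnit.residue_eq_one {p : ℕ} [Fact p.Prime] {k : ℕ} {O : Type*} [CommRing O]
    [IsDomain O] [IsDiscreteValuationRing O] [IsAdicComplete (maximalIdeal O) O]
    [CharP (O ⧸ maximalIdeal O) p] {ϖ : O} (hϖ : Irreducible ϖ) {T : ℕ → O → Set O} {A₀ b₀ : ℕ}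
    {ω a : O} (hi : 0 < p ^ k * A₀ - b₀)
    (h : IsStandardUnit p k ϖ T A₀ b₀ ω a) : residue O a = 1 := by
  have hϖ0 : residue O ϖ = 0 := (residue_eq_zero_iff _).2 hϖ.not_isUnit
  have hsum : ∀ (α : ℕ → O) (N : ℕ), residue O (∑ j ∈ Finset.Icc 1 N, α j * ϖ ^ j) = 0 := by
    intro α N
    rw [map_sum]
    refine Finset.sum_eq_zero fun j hj ↦ ?_
    have : j ≠ 0 := by have := (Finset.mem_Icc.1 hj).1; omega
    rw [map_mul, map_pow, hϖ0, zero_pow this, mul_zero]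
  obtain ⟨α, -, -, ⟨-, rfl⟩ | ⟨hd, γ, -, rfl⟩⟩ := h
  · rw [map_add, map_one, hsum, add_zero]
  · -- here `B > 0`, as `i₀ > 0`
    obtain ⟨B, hB⟩ := hd
    have hB0 : (p ^ k * A₀ - b₀) / (p ^ k - 1) ≠ 0 := by
      rw [hB] at hi ⊢
      rw [Nat.mul_div_cancel_left _ (pos_of_mul_pos_left hi (Nat.zero_le _))]
      exact (pos_of_mul_pos_right hi (Nat.zero_le _)).ne'
    rw [map_add, map_add, map_one, hsum, map_mul, map_pow, hϖ0, zero_pow hB0, mul_zero, add_zero,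
      add_zero]

/-- The root of a standard form polynomial carries `RamificationData`, with
`e = (-1) ^ b ω (ϖ / θ ^ (p ^ k)) ^ A`. As `(-1) ^ (p ^ k) = -1` in the residue field, the unit
`ϖ / θ ^ (p ^ k)` reduces to `1`. -/
theorem EisensteinRoot.exists_ramificationData {p k A b : ℕ} (hp : p.Prime) {O : Type*}
    [CommRing O] [IsDomain O]
    [IsDiscreteValuationRing O] [CharP (ResidueField O) p] {ϖ ω a : O} (hϖ : Irreducible ϖ)
    (hk : k ≠ 0) (hA : A ≠ 0) (hAp : ϖ ^ A ∣ (p : O)) (hb : 0 < b) (hbq : b < p ^ k) (hpb : ¬ p ∣ b)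
    (hω : IsUnit ω) (ha : residue O a = 1) {f g : O[X]}
    (hmon : f.Monic) [IsDomain (AdjoinRoot f)] [IsDiscreteValuationRing (AdjoinRoot f)]
    (hn : p ^ k ≠ 0) (hf : f = X ^ p ^ k + C ϖ * g)
    (hg : g = C ((-1) ^ b * ω * ϖ ^ (A - 1)) * X ^ (p ^ k - b) + C ((-1) ^ p ^ k * a)) :
    ∃ e, RamificationData p k (p ^ k * A - b) (p ^ k - b) f (residueMap hϖ hn hf)
      (AdjoinRoot.root f) e ∧
      residueMap hϖ hn hf (e * (p ^ k - b : ℕ)) = -residue O ((-1) ^ b * b * ω) := by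
  have hm : p ^ k - b ≠ 0 := by omega
  have hg0 : g.coeff 0 = (-1) ^ p ^ k * a := by
    rw [hg, coeff_add, coeff_C_zero, coeff_C_mul, coeff_X_pow, if_neg hm.symm, mul_zero, zero_add]
  have hp1 : Fact p.Prime := ⟨hp⟩
  have hg0r : residue O (g.coeff 0) = -1 := by
    rw [hg0, map_mul, ha, map_pow, map_neg, map_one, mul_one, neg_one_pow_char_pow]
  have hg0u : IsUnit (g.coeff 0) := by
    rw [← residue_ne_zero_iff_isUnit, hg0r]
    exact neg_ne_zero.2 one_ne_zero
  obtain ⟨w, hw, hwr⟩ := exists_unit hϖ hn hf hmon hg0u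
  have hwr' : residueMap hϖ hn hf w = 1 := by rw [hwr, hg0r, neg_neg]
  have hwinv : residueMap hϖ hn hf (w⁻¹ : (AdjoinRoot f)ˣ) = 1 := by
    have := congrArg (residueMap hϖ hn hf) w.mul_inv
    rwa [map_mul, hwr', one_mul, map_one] at this
  set θ := AdjoinRoot.root f with hθ
  have hϖθ : algebraMap O (AdjoinRoot f) ϖ = θ ^ p ^ k * (w⁻¹ : (AdjoinRoot f)ˣ) := by
    rw [hw, mul_assoc, Units.mul_inv, mul_one]
  have hAq : p ^ k ≤ p ^ k * A := Nat.le_mul_of_pos_right _ (Nat.pos_of_ne_zero hA)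
  have hbres : ((p ^ k - b : ℕ) : ResidueField O) = -b := by
    rw [Nat.cast_sub hbq.le]
    simp [hk]
  set e : AdjoinRoot f := algebraMap O _ ((-1) ^ b * ω) * (w⁻¹ : (AdjoinRoot f)ˣ) ^ A with he
  have hem : residueMap hϖ hn hf (e * (p ^ k - b : ℕ)) = -residue O ((-1) ^ b * b * ω) := by
    rw [map_mul, map_natCast, hbres, he, map_mul, map_pow, hwinv, residueMap_algebraMap]
    simp only [map_mul, map_pow, map_neg, map_one, map_natCast, one_pow]
    ring
  have hirr : Irreducible θ := by
    rw [IsDiscreteValuationRing.irreducible_iff_uniformizer]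
    exact maximalIdeal_eq hϖ hn hf hmon hg0u
  refine ⟨e, ⟨hirr, isUnit_iff hϖ hn hf hmon, dvd_iff hϖ hn hf hmon hg0u, ?_,
    AdjoinRoot.adjoinRoot_eq_top, by omega, ?_, ?_, ?_⟩, hem⟩
  · intro x
    obtain ⟨o, rfl⟩ := residue_surjective x
    exact ⟨o, residueMap_algebraMap hϖ hn hf o⟩
  · have h1 : (p : AdjoinRoot f) = algebraMap O _ (p : O) := (map_natCast _ _).symm
    rw [h1]
    refine dvd_trans ?_ (_root_.map_dvd _ hAp)
    rw [map_pow, hϖθ, mul_pow, ← pow_mul]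
    exact (pow_dvd_pow _ (by omega)).mul_right _
  · intro t
    have hfe : ∀ x : AdjoinRoot f, aeval x f = x ^ p ^ k + algebraMap O _ ((-1) ^ b * ω) *
        algebraMap O _ ϖ ^ A * x ^ (p ^ k - b) + algebraMap O _ (ϖ * ((-1) ^ p ^ k * a)) := by
      intro x
      have hA' : ϖ ^ A = ϖ * ϖ ^ (A - 1) := by
        rw [← pow_succ', Nat.sub_add_cancel (Nat.pos_of_ne_zero hA)]
      rw [← map_pow, hA']
      have : aeval x f = aeval x (X ^ p ^ k + C ϖ * g) := by rw [← hf]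
      rw [this, hg]
      simp only [map_add, map_mul, map_pow, aeval_X, aeval_C]
      ring
    have h0 : aeval θ f = 0 := by rw [hθ, AdjoinRoot.aeval_eq, AdjoinRoot.mk_self]
    have h1 : algebraMap O (AdjoinRoot f) ϖ ^ A * θ ^ (p ^ k - b) =
        θ ^ p ^ k * (θ ^ (p ^ k * A - b) * (w⁻¹ : (AdjoinRoot f)ˣ) ^ A) := by
      rw [hϖθ, mul_pow, ← pow_mul, mul_right_comm, ← pow_add, ← mul_assoc, ← pow_add]
      congr 2
      omega
    rw [← sub_zero (aeval (θ * t) f), ← h0, hfe, hfe, he]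
    rw [mul_pow, mul_pow]
    linear_combination (algebraMap O (AdjoinRoot f) ((-1) ^ b * ω) * (t ^ (p ^ k - b) - 1)) * h1
  · rw [hem, neg_ne_zero]
    have hbO : (b : ResidueField O) ≠ 0 := by rwa [Ne, CharP.cast_eq_zero_iff _ p]
    have hωr : residue O ω ≠ 0 := (residue_ne_zero_iff_isUnit ω).2 hω
    simp [hbO, hωr]

/-! ### The fraction field -/

theorem AdjoinRoot.isFractionRing_of_adjoin_eq_top {O K L : Type*} [CommRing O] [IsDomain O]
    [Field K] [Algebra O K] [IsFractionRing O K] [Field L] [Algebra K L] [Algebra O L]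
    [IsScalarTower O K L] {f : O[X]} [IsDomain (AdjoinRoot f)] (hmon : f.Monic)
    [Algebra (AdjoinRoot f) L] [IsScalarTower O (AdjoinRoot f) L]
    (hgen : K⟮algebraMap (AdjoinRoot f) L (AdjoinRoot.root f)⟯ = ⊤) :
    IsFractionRing (AdjoinRoot f) L := by
  have := hmon.finite_adjoinRoot
  have hinjO : Function.Injective (algebraMap O L) := by
    rw [IsScalarTower.algebraMap_eq O K L]
    exact (algebraMap K L).injective.comp (IsFractionRing.injective O K)
  have hinj : Function.Injective (algebraMap (AdjoinRoot f) L) := by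
    rw [RingHom.injective_iff_ker_eq_bot]
    refine Ideal.eq_bot_of_comap_eq_bot (R := O) ?_
    rw [RingHom.comap_ker, ← IsScalarTower.algebraMap_eq]
    exact (RingHom.injective_iff_ker_eq_bot _).1 hinjO
  have : FaithfulSMul (AdjoinRoot f) L := (faithfulSMul_iff_algebraMap_injective _ _).2 hinj
  refine .of_field _ _ fun z ↦ ?_
  have hz : z ∈ K⟮algebraMap (AdjoinRoot f) L (AdjoinRoot.root f)⟯ := hgen ▸ IntermediateField.mem_top
  induction hz using IntermediateField.adjoin_induction with
  | mem x hx => exact ⟨AdjoinRoot.root f, 1, by rw [Set.mem_singleton_iff.1 hx]; simp⟩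
  | algebraMap x =>
    obtain ⟨a, b, -, rfl⟩ := IsFractionRing.div_surjective (A := O) x
    refine ⟨algebraMap O _ a, algebraMap O _ b, ?_⟩
    rw [map_div₀]
    simp only [← IsScalarTower.algebraMap_apply]
  | add x y hx hy ihx ihy =>
    obtain ⟨a, b, rfl⟩ := ihx
    obtain ⟨c, d, rfl⟩ := ihy
    -- a vanishing denominator gives the junk quotient `0`
    by_cases hb : algebraMap (AdjoinRoot f) L b = 0
    · exact ⟨c, d, by rw [hb, div_zero, zero_add]⟩
    by_cases hd : algebraMap (AdjoinRoot f) L d = 0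
    · exact ⟨a, b, by rw [hd, div_zero, add_zero]⟩
    exact ⟨a * d + b * c, b * d, by rw [div_add_div _ _ hb hd]; simp⟩
  | inv x hx ih =>
    obtain ⟨a, b, rfl⟩ := ih
    exact ⟨b, a, inv_div _ _⟩
  | mul x y hx hy ihx ihy =>
    obtain ⟨a, b, rfl⟩ := ihx
    obtain ⟨c, d, rfl⟩ := ihy
    exact ⟨a * c, b * d, by rw [div_mul_div_comm]; simp⟩

/-! ### The Galois group of a standard form polynomial -/

/-- If the residue of the Teichmüller representative of `x` vanishes, so do all components of `x`, as
each is a `p`-th power root of the residue. -/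
theorem isUnit_of_mem_teichmullerReps {p : ℕ} [Fact p.Prime] {O : Type*} [CommRing O]
    [IsLocalRing O] [IsAdicComplete (maximalIdeal O) O] [CharP (O ⧸ maximalIdeal O) p] {ω : O}
    (hω : ω ∈ teichmullerReps p O) (h0 : ω ≠ 0) : IsUnit ω := by
  obtain ⟨x, rfl⟩ := hω
  rw [← residue_ne_zero_iff_isUnit]
  intro h
  refine h0 ?_
  suffices x = 0 by rw [this, Perfection.teichmuller_zero]
  have hpow : ∀ n, Perfection.coeff (O ⧸ maximalIdeal O) p n x = 0 := by
    intro n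
    induction n with
    | zero => rw [← Perfection.mk_teichmuller]; exact h
    | succ n ih =>
      rw [← Perfection.coeff_pow_p'] at ih
      exact eq_zero_of_pow_eq_zero (R := ResidueField O) ih
  ext n
  rw [hpow, map_zero]

theorem henselianLocalRing_of_isAdicComplete (R : Type*) [CommRing R] [IsLocalRing R]
    [IsAdicComplete (maximalIdeal R) R] : HenselianLocalRing R where
  is_henselian f hf a₀ h₁ h₂ :=
    HenselianRing.is_henselian (I := maximalIdeal R) f hf a₀ h₁ (h₂.map _)

theorem corollary7p4 (p : ℕ) [Fact p.Prime] (k : ℕ) (hk : 1 ≤ k)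
    {O : Type*} [CommRing O] [IsDomain O] [IsDiscreteValuationRing O]
    [IsAdicComplete (maximalIdeal O) O]
    [CharP (O ⧸ maximalIdeal O) p] [PerfectField (ResidueField O)]
    {K : Type*} [Field K] [Algebra O K] [IsFractionRing O K]
    (ϖ : O) (hϖ : Irreducible ϖ)
    (T : ℕ → O → Set O) (hT : IsCosetChoice p k T)
    (A₀ b₀ : ℕ) (ω : O) (f : O[X]) (hf : IsStandardForm p k ϖ T A₀ b₀ ω f)
    {L : Type*} [Field L] [Algebra K L]
    (πL : L) (hroot : aeval πL (f.map (algebraMap O K)) = 0) (hgen : K⟮πL⟯ = ⊤) :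
    (IsGalois K L ↔
      (∃ ζ : K, IsPrimitiveRoot ζ (p ^ k - 1)) ∧
      (∃ y : K, y ^ (p ^ k - 1) =
        (-1) ^ b₀ * (b₀ : K) * algebraMap O K ω * algebraMap O K ϖ ^ (p ^ k - b₀ + A₀ - 1))) ∧
    (IsGalois K L → Nonempty ((L ≃ₐ[K] L) ≃* Multiplicative (Fin k → ZMod p))) := by
  have hp : p.Prime := Fact.out
  have : CharP (ResidueField O) p := inferInstanceAs (CharP (O ⧸ maximalIdeal O) p)
  obtain ⟨heis, hdeg, hdata, a, ha, hfa⟩ := hf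
  have hk0 : k ≠ 0 := by omega
  have hA1 := hdata.one_le_A
  have hb1 := hdata.one_le_b
  have hpk : p ∣ p ^ k := dvd_pow_self p hk0
  have hbq : b₀ < p ^ k := lt_of_le_of_ne hdata.b_le fun h ↦ hdata.not_dvd (h ▸ hpk)
  have hq1 : 1 < p ^ k := Nat.one_lt_pow hk0 hp.one_lt
  have hAq : p ^ k ≤ p ^ k * A₀ := Nat.le_mul_of_pos_right _ hA1
  have hn : p ^ k ≠ 0 := by omega
  have hωu := isUnit_of_mem_teichmullerReps hdata.mem hdata.ne_zero
  have har : residue O a = 1 := ha.residue_eq_one hϖ (by omega)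
  have hAp : ϖ ^ A₀ ∣ (p : O) := by
    rw [← IsDiscreteValuationRing.addVal_le_iff_dvd, hϖ.addVal_pow]
    exact hdata.A_le
  -- the structure of `O[X] / (f)`
  obtain ⟨g, hg⟩ : ∃ g : O[X], g = C ((-1) ^ b₀ * ω * ϖ ^ (A₀ - 1)) * X ^ (p ^ k - b₀) +
    C ((-1) ^ p ^ k * a) := ⟨_, rfl⟩
  have hfg : f = X ^ p ^ k + C ϖ * g := by
    obtain ⟨A, rfl⟩ := Nat.exists_eq_add_of_le' hA1
    rw [hfa, hg, Nat.add_sub_cancel]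
    simp only [C_mul, C_pow, pow_succ]
    ring
  have hmon : f.Monic := by
    rw [hfa, add_assoc]
    refine monic_X_pow_add ((degree_add_le _ _).trans_lt (max_lt ?_ ?_))
    · exact (degree_C_mul_X_pow_le _ _).trans_lt (by exact_mod_cast (by omega))
    · exact degree_C_le.trans_lt (by exact_mod_cast (by omega))
  have hfirr : Irreducible f := heis.irreducible inferInstance hmon.isPrimitive (by omega)
  have : IsDomain (AdjoinRoot f) := AdjoinRoot.isDomain_of_prime hfirr.prime
  have hfin := hmon.finite_adjoinRoot
  have hg0 : IsUnit (g.coeff 0) := by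
    have ha0 : IsUnit a := by
      rw [← residue_ne_zero_iff_isUnit, har]
      exact one_ne_zero
    rw [hg, coeff_add, coeff_C_zero, coeff_C_mul, coeff_X_pow, if_neg (by omega), mul_zero, zero_add]
    exact (isUnit_one.neg.pow _).mul ha0
  have : IsDiscreteValuationRing (AdjoinRoot f) :=
    EisensteinRoot.isDiscreteValuationRing hϖ hn hfg hmon hg0
  have := EisensteinRoot.isAdicComplete hϖ hn hfg hmon hg0
  have := henselianLocalRing_of_isAdicComplete O
  have := henselianLocalRing_of_isAdicComplete (AdjoinRoot f)
  obtain ⟨e, hR, hem⟩ := EisensteinRoot.exists_ramificationData hp hϖ hk0 (by omega) hAp hb1 hbq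
    hdata.not_dvd hωu har hmon hn hfg hg
  have hc : IsUnit ((-1) ^ b₀ * (b₀ : O) * ω) := by
    rw [← residue_ne_zero_iff_isUnit, ← neg_ne_zero, ← hem]
    exact hR.ne_zero
  -- `L` is its field of fractions
  let _ : Algebra O L := ((algebraMap K L).comp (algebraMap O K)).toAlgebra
  have : IsScalarTower O K L := .of_algebraMap_eq fun _ ↦ rfl
  rw [aeval_map_algebraMap] at hroot
  let φ : AdjoinRoot f →ₐ[O] L := AdjoinRoot.liftAlgHom f (Algebra.ofId O L) πL hroot
  let _ : Algebra (AdjoinRoot f) L := φ.toRingHom.toAlgebra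
  have : IsScalarTower O (AdjoinRoot f) L := .of_algebraMap_eq fun x ↦ (φ.commutes x).symm
  have hφ : algebraMap (AdjoinRoot f) L (AdjoinRoot.root f) = πL := AdjoinRoot.liftAlgHom_root _ _ _ _
  have : IsFractionRing (AdjoinRoot f) L :=
    AdjoinRoot.isFractionRing_of_adjoin_eq_top (K := K) hmon (by rw [hφ]; exact hgen)
  have hint : IsIntegral K πL := ⟨f.map (algebraMap O K), hmon.map _, by
    rw [← aeval_def, aeval_map_algebraMap, hroot]⟩
  have hrank : Module.finrank K L = p ^ k := by
    have hmin : minpoly K πL = f.map (algebraMap O K) :=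
      (minpoly.eq_of_irreducible_of_monic
        ((hmon.irreducible_iff_irreducible_map_fraction_map (K := K)).1 hfirr)
        (by rw [aeval_map_algebraMap, hroot]) (hmon.map _)).symm
    rw [← IntermediateField.finrank_top', ← hgen, IntermediateField.adjoin.finrank hint, hmin,
      hmon.natDegree_map, hdeg]
  have : FiniteDimensional K L := Module.finite_of_finrank_pos (by omega)
  have hIC : IsIntegralClosure (AdjoinRoot f) O L :=
    IsIntegralClosure.of_isIntegrallyClosed _ _ _
  let γ := galRestrict O K L (AdjoinRoot f)
  -- the homomorphism to the residue field
  have hres : IsGalois K L → (p ^ k - 1) ∣ (p ^ k * A₀ - b₀) ∧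
      ∃ δ : (AdjoinRoot f ≃ₐ[O] AdjoinRoot f) →* Multiplicative (ResidueField O),
        Function.Injective δ ∧
        ∀ s, s ≠ 1 → (δ s).toAdd ^ (p ^ k - 1) = residue O ((-1) ^ b₀ * b₀ * ω) := by
    intro hG
    have hcard := IsGalois.card_aut_eq_finrank K L
    rw [hrank, Nat.card_congr γ.toEquiv] at hcard
    have : Finite (AdjoinRoot f ≃ₐ[O] AdjoinRoot f) := Nat.finite_of_card_ne_zero (by omega)
    have : Nontrivial (AdjoinRoot f ≃ₐ[O] AdjoinRoot f) :=
      Finite.one_lt_card_iff_nontrivial.1 (by omega)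
    -- a nontrivial automorphism shows that the slope is an integer
    obtain ⟨s, hs⟩ := exists_ne (1 : AdjoinRoot f ≃ₐ[O] AdjoinRoot f)
    obtain ⟨B, -, hB, -⟩ := hR.exists_of_algEquiv hp hs
    obtain ⟨δ, hδ, hδc⟩ := hR.exists_residueHom hp hk0 hB
    rw [hem, neg_neg] at hδc
    exact ⟨⟨B, hB⟩, δ, hδ, hδc⟩
  have hcardR : IsGalois K L → Nat.card (AdjoinRoot f ≃ₐ[O] AdjoinRoot f) = p ^ k := fun hG ↦ by
    rw [← Nat.card_congr γ.toEquiv, IsGalois.card_aut_eq_finrank K L, hrank]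
  -- the arithmetic conditions in terms of the residue field
  have hnκ : ((p ^ k - 1 : ℕ) : ResidueField O) ≠ 0 := by
    rw [Nat.cast_sub hq1.le]
    simp [hk0]
  have hy : (∃ y : K, y ^ (p ^ k - 1) = (-1) ^ b₀ * (b₀ : K) * algebraMap O K ω *
      algebraMap O K ϖ ^ (p ^ k - b₀ + A₀ - 1)) ↔ (p ^ k - 1) ∣ (p ^ k * A₀ - b₀) ∧
        ∃ x, x ^ (p ^ k - 1) = residue O ((-1) ^ b₀ * b₀ * ω) := by
    have hdvd : (p ^ k - 1) ∣ (p ^ k * A₀ - b₀) ↔ (p ^ k - 1) ∣ (p ^ k - b₀ + A₀ - 1) := by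
      have : p ^ k * A₀ - b₀ = (p ^ k - 1) * (A₀ - 1) + (p ^ k - b₀ + A₀ - 1) := by
        obtain ⟨A, rfl⟩ := Nat.exists_eq_add_of_le' hA1
        obtain ⟨q, hq⟩ := Nat.exists_eq_add_of_le' hq1.le
        rw [hq] at hbq ⊢
        simp only [Nat.add_sub_cancel]
        have : (q + 1) * (A + 1) = q * A + q + A + 1 := by ring
        omega
      rw [this, Nat.dvd_add_right (dvd_mul_right _ _)]
    rw [hdvd, ← exists_pow_eq_unit_mul_iff (K := K) hnκ hc hϖ]
    simp only [map_mul, map_pow, map_neg, map_one, map_natCast]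
  rw [exists_isPrimitiveRoot_iff_residueField hnκ, hy]
  refine ⟨⟨fun hG ↦ ?_, ?_⟩, fun hG ↦ ?_⟩
  · obtain ⟨hd, δ, hδ, hδc⟩ := hres hG
    have hcr : residue O ((-1) ^ b₀ * b₀ * ω) ≠ 0 := (residue_ne_zero_iff_isUnit _).2 hc
    obtain ⟨h1, h2⟩ := exists_isPrimitiveRoot_of_injective (n := p ^ k - 1)
      (δ := fun s ↦ (δ s).toAdd) hδ hcr (by omega) hδc (by rw [hcardR hG]; omega)
    exact ⟨h1, hd, h2⟩
  · rintro ⟨⟨ζ, hζ⟩, hd, x, hx⟩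
    obtain ⟨Z, hZcard, hZ⟩ := hR.exists_finset_roots
      (Function.Surjective.of_comp (g := algebraMap O (AdjoinRoot f)) hR.surjective) hp hk0
      (by omega) hd hζ (by rw [hem, neg_neg, hx])
    refine isGalois_of_card_roots (hmon.map (algebraMap O K)).ne_zero
      (by rw [aeval_map_algebraMap, hroot]) hgen
      (Z := Z.map ⟨algebraMap (AdjoinRoot f) L, IsFractionRing.injective _ _⟩) ?_ ?_
    · intro z hz
      obtain ⟨r, hr, rfl⟩ := Finset.mem_map.1 hz
      rw [aeval_map_algebraMap, Function.Embedding.coeFn_mk, aeval_algebraMap_apply, hZ r hr,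
        map_zero]
    · rw [Finset.card_map, hZcard, hmon.natDegree_map, hdeg]
  · obtain ⟨-, δ, hδ, -⟩ := hres hG
    obtain ⟨E⟩ := nonempty_mulEquiv_of_injective hδ (hcardR hG)
    exact ⟨γ.trans E⟩
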